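/- Let $L>0$, $M\ge 0$, $m\in\mathbb N$ and $\Pi^3=[-L,L]^3$. Let $(\varphi_j)_{j\in\mathbb N}$ be a sequence of real-valued functions in $L^\infty(\Pi^3)$ with $\|\varphi_j\|_{L^\infty(\Pi^3)}\le M$ for all $j$, extended to $\mathbb R^3$ as functions that are $2L$-periodic in each coordinate. For $n\in\mathbb S^2$ put $$L_n[\varphi](x)=\int_{-L}^{L}\varphi(x-\lambda n)\,d\lambda,\qquad T_m[\varphi](x)=\int_{\mathbb S^2}\big(L_n[\varphi](x)\big)^m\,dn,$$ where $dn$ is the surface measure on $\mathbb S^2$. These are well defined almost everywhere: for every $j$ and every $n\in\mathbb S^2$ the integral $L_n[\varphi_j](x)$ converges absolutely for almost every $x\in\mathbb R^3$, and for every $j$ the integral $T_m[\varphi_j](x)$ converges absolutely for almost every $x\in\mathbb R^3$. Moreover, the functions $T_m[\varphi_j]$ belong to $L^2(\Pi^3)$, and the set $\{T_m[\varphi_j]: j\in\mathbb N\}$ is relatively compact in $L^2(\Pi^3)$. More precisely, there is a constant $C_m>0$ depending only on $m$, $M$ and $L$ (and not on the sequence) such that for every $\varepsilon>0$ there is $h_0>0$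 with $$\int_{\Pi^3}\big|T_m[\varphi_j](x)-T_m[\varphi_j](x+h)\big|^2dx\ \le\ C_m\int_{\Pi^3}\int_{\mathbb S^2}\big|L_n[\varphi_j](x)-L_n[\varphi_j](x+h)\big|^2\,dn\,dx\ <\ \varepsilon$$ for all $j\in\mathbb N$ and all $h\in\mathbb R^3$ with $|h|<h_0$. -/

import Mathlib

open MeasureTheory

open scoped ENNReal NNReal

namespace LineIntegrals

/-- Euclidean space `ℝ³` (with the Euclidean norm). -/
abbrev E3 : Type := EuclideanSpace ℝ (Fin 3)

/-- The unit sphere `𝕊²` of `ℝ³`. -/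
abbrev S2 : Type := Metric.sphere (0 : E3) 1

/-- The surface measure `dn` on `𝕊²`, of total mass `4π`. -/
noncomputable abbrev surf : Measure S2 := (volume : Measure E3).toSphere

/-- The cube `Π³ = [-L, L]³`. -/
def cube (L : ℝ) : Set E3 := {x | ∀ i, x i ∈ Set.Icc (-L) L}

/-- Lebesgue measure on the cube `Π³`. -/
noncomputable abbrev cubeMeasure (L : ℝ) : Measure E3 := volume.restrict (cube L)

/-- A function on `ℝ³` that is `2L`-periodic in each coordinate: the periodic extension
of a function on `Π³`. -/
def IsCubePeriodic (L : ℝ) (φ : E3 → ℝ) : Prop :=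
  ∀ i : Fin 3, Function.Periodic φ (EuclideanSpace.single i (2 * L))

/-- `L_n[φ](x) = ∫_{-L}^{L} φ(x - λ n) dλ`. -/
noncomputable def lineInt (L : ℝ) (n : S2) (φ : E3 → ℝ) (x : E3) : ℝ :=
  ∫ t in (-L)..L, φ (x - t • (n : E3))

/-- `T_m[φ](x) = ∫_{𝕊²} (L_n[φ](x))^m dn`. -/
noncomputable def sphereInt (L : ℝ) (m : ℕ) (φ : E3 → ℝ) (x : E3) : ℝ :=
  ∫ n : S2, (lineInt L n φ x) ^ m ∂surf

end LineIntegrals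

/-! A single `L_n` smooths only in the direction `n`; averaging over `𝕊²` is what gives compactness.
For integrable bounded `ψ`, expanding the square shows that `‖L_n ψ‖²` in `L²(ℝ³)` is the
autocorrelation of `ψ` along the line of direction `n`, weighted by the tent `(2L - |u|)₊`
(`integral_sq_segment`). Integrating over `n` and reading `(n, u)` as polar coordinates turns this
into `2 ∫ ψ · (K * ψ)` with `K(y) = (2L - |y|)₊ / |y|²`
(`integral_sphere_tent_mul_autocorrelation`), and `K` is integrable on `ℝ³`.

For `ψ = f - f(· + h)` the shift passes from `f` to the kernel, so `|K * ψ| ≤ M ‖K(· + h) - K‖₁`.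
The quadratic form is then at most `2M ‖f‖₁ ‖K(· + h) - K‖₁`, which tends to `0` with `h` by
continuity of translations in `L¹`, at a rate depending only on `M`, `‖f‖₁` and `L`
(`lintegral_sphere_lintegral_sq_sub_le`). Cutting off outside a large ball transfers this to
periodic functions.

Since `|L_n| ≤ 2LM`, the power `a ↦ a^m` is Lipschitz on the relevant range, and Cauchy–Schwarz on
the sphere bounds increments of `T_m` by those of `L_n`. Compactness follows from the
Kolmogorov–Riesz criterion, proved here with ball averages and Arzelà–Ascoli. -/

namespace LineIntegrals

open Metric Set Filter Topology

/-! ### Translation invariance of convolutions and autocorrelations -/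

section Invariant

variable {E : Type*} [NormedAddCommGroup E] [MeasurableSpace E] [BorelSpace E]
  {μ : Measure E} [μ.IsAddHaarMeasure]

/-- By invariance the shift moves from `f` to the kernel, so the modulus of continuity depends on
`f` only through its bound. Applied to `segmentKernel` and to the normalised indicator of a ball. -/
theorem abs_integral_mul_sub_le {k f : E → ℝ} (hk : Integrable k μ) (hf : Measurable f)
    {B : ℝ} (hB : ∀ x, |f x| ≤ B) (x h : E) :
    |(∫ y, k y * f (x - y) ∂μ) - ∫ y, k y * f (x + h - y) ∂μ|
      ≤ B * ∫ y, |k (y + h) - k y| ∂μ := by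
  have hkh : Integrable (fun y => k (y + h)) μ := hk.comp_add_right h
  have hi : ∀ {q : E → ℝ} (_ : Integrable q μ) (z : E),
      Integrable (fun y => q y * f (z - y)) μ := by
    intro q hq z
    refine hq.mul_bdd (c := B) (Measurable.aestronglyMeasurable (by fun_prop))
      (.of_forall fun y => hB _)
  have h1 : ∫ y, k y * f (x + h - y) ∂μ = ∫ y, k (y + h) * f (x - y) ∂μ := by
    rw [← integral_add_right_eq_self (fun y => k y * f (x + h - y)) h]
    simp
  rw [h1, ← integral_sub (hi hk x) (hi hkh x), ← integral_const_mul]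
  refine (abs_integral_le_integral_abs).trans ?_
  refine integral_mono_of_nonneg (.of_forall fun _ => abs_nonneg _)
    ((hkh.sub hk).abs.const_mul B) (.of_forall fun y => ?_)
  simp only
  rw [← sub_mul, abs_mul, mul_comm, abs_sub_comm]
  exact mul_le_mul_of_nonneg_right (hB _) (abs_nonneg _)

theorem integral_mul_translate_neg (ψ : E → ℝ) (y : E) :
    ∫ x, ψ x * ψ (x - -y) ∂μ = ∫ x, ψ x * ψ (x - y) ∂μ := by
  rw [← integral_sub_right_eq_self (fun x => ψ x * ψ (x - -y)) y]
  refine integral_congr_ae (.of_forall fun x => ?_)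
  simp [mul_comm]

end Invariant

/-! ### Continuity of translations in `L¹`, and polar coordinates -/

section Translation

variable {E : Type*} [NormedAddCommGroup E] [NormedSpace ℝ E] [FiniteDimensional ℝ E]
  [MeasurableSpace E] [BorelSpace E] {μ : Measure E} [μ.IsAddHaarMeasure]

/-- Translations act continuously on `L¹`. -/
theorem exists_integral_abs_translate_sub_lt {k : E → ℝ} (hk : Integrable k μ) {ε : ℝ}
    (hε : 0 < ε) : ∃ δ > 0, ∀ h : E, ‖h‖ < δ → ∫ y, |k (y + h) - k y| ∂μ < ε := by
  have hk1 : MemLp k 1 μ := memLp_one_iff_integrable.2 hk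
  have hc : Continuous fun h : E => (DomAddAct.mk h) +ᵥ hk1.toLp k := by
    have hmk : Continuous fun h : E => DomAddAct.mk h := DomAddAct.continuous_mk
    have : Fact ((1 : ℝ≥0∞) ≠ ∞) := ⟨ENNReal.one_ne_top⟩
    exact Continuous.vadd hmk continuous_const
  have h0 := Metric.continuous_iff.1 hc 0 ε hε
  obtain ⟨δ, hδ, H⟩ := h0
  refine ⟨δ, hδ, fun h hh => ?_⟩
  have := H h (by simpa using hh)
  rw [DomAddAct.mk_zero, zero_vadd, DomAddAct.mk_vadd_toLp, dist_eq_norm, ← MemLp.toLp_sub,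
    L1.norm_eq_integral_norm] at this
  refine lt_of_le_of_lt (le_of_eq ?_) this
  refine integral_congr_ae ?_
  filter_upwards [MemLp.coeFn_toLp ((hk1.comp_measurePreserving
    (measurePreserving_vadd h μ)).sub hk1)] with y hy
  refine Eq.trans ?_ (congrArg norm hy).symm
  simp [add_comm]

/-- Integration in polar coordinates. -/
theorem integral_eq_integral_sphere_integral_Ioi [Nontrivial E] {f : E → ℝ} (hf : Integrable f μ) :
    ∫ x, f x ∂μ = ∫ n : sphere (0 : E) 1,
      (∫ r in Ioi (0 : ℝ), r ^ (Module.finrank ℝ E - 1) * f (r • (n : E))) ∂μ.toSphere := by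
  have hmp := μ.measurePreserving_homeomorphUnitSphereProd
  have hemb := (homeomorphUnitSphereProd E).measurableEmbedding
  set F : sphere (0 : E) 1 × Ioi (0 : ℝ) → ℝ := fun p => f ((p.2 : ℝ) • (p.1 : E)) with hF
  have hFc : ∀ x : ({0}ᶜ : Set E), F (homeomorphUnitSphereProd E x) = f x := by
    intro x
    simp only [hF]
    have hx : ‖(x : E)‖ ≠ 0 := norm_ne_zero_iff.2 x.2
    simp [smul_smul, hx]
  have hint : Integrable F (μ.toSphere.prod (.volumeIoiPow (Module.finrank ℝ E - 1))) := by
    rw [← hmp.integrable_comp_emb hemb]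
    have : (F ∘ homeomorphUnitSphereProd E) = fun x : ({0}ᶜ : Set E) => f x := funext hFc
    rw [this]
    have h1 : IntegrableOn f ({0}ᶜ) μ := hf.integrableOn
    rwa [integrableOn_iff_comap_subtypeVal (measurableSet_singleton _).compl] at h1
  calc
    ∫ x, f x ∂μ = ∫ x : ({(0)}ᶜ : Set E), f x ∂(μ.comap (↑)) := by
      rw [integral_subtype_comap (measurableSet_singleton _).compl f, restrict_compl_singleton]
    _ = ∫ p, F p ∂(μ.toSphere.prod (.volumeIoiPow (Module.finrank ℝ E - 1))) := by
      rw [← hmp.integral_comp hemb]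
      exact integral_congr_ae (.of_forall fun x => (hFc x).symm)
    _ = _ := by
      rw [integral_prod _ hint]
      refine integral_congr_ae (.of_forall fun n => ?_)
      simp only [hF, Measure.volumeIoiPow, ENNReal.ofReal]
      rw [integral_withDensity_eq_integral_smul,
        integral_subtype_comap measurableSet_Ioi
          fun a : ℝ ↦ Real.toNNReal (a ^ (Module.finrank ℝ E - 1)) • f (a • (n : E)),
        setIntegral_congr_fun measurableSet_Ioi fun x hx ↦ ?_]
      · rw [NNReal.smul_def, Real.coe_toNNReal _ (pow_nonneg hx.out.le _), smul_eq_mul]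
      · exact (measurable_subtype_coe.pow_const _).real_toNNReal

end Translation

/-! ### Line integrals and autocorrelation -/

section Correlation

variable {E : Type*} [NormedAddCommGroup E] [NormedSpace ℝ E] [FiniteDimensional ℝ E]
  [MeasurableSpace E] [BorelSpace E] {μ : Measure E} [μ.IsAddHaarMeasure]

theorem integral_indicator_mul_indicator_add {L : ℝ} (u : ℝ) :
    ∫ s, (Ioc (-L) L).indicator (1 : ℝ → ℝ) s * (Ioc (-L) L).indicator (1 : ℝ → ℝ) (s + u)
      = max (2 * L - |u|) 0 := by
  have : (fun s => (Ioc (-L) L).indicator (1 : ℝ → ℝ) s *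
        (Ioc (-L) L).indicator (1 : ℝ → ℝ) (s + u))
      = (Ioc (max (-L) (-L - u)) (min L (L - u))).indicator (1 : ℝ → ℝ) := by
    ext s
    simp only [indicator_apply, mem_Ioc, Pi.one_apply]
    by_cases h1 : -L < s ∧ s ≤ L <;> by_cases h2 : -L < s + u ∧ s + u ≤ L <;>
      simp only [h1, h2] <;> grind
  rw [this, integral_indicator_one measurableSet_Ioc, Real.volume_real_Ioc]
  congr 1
  rcases abs_cases u with ⟨h, h'⟩ | ⟨h, h'⟩ <;> rw [h] <;> grind

/-- The square of the `L²` norm of the integral of `ψ` along segments of direction `v`. -/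
theorem integral_sq_segment (L : ℝ) {ψ : E → ℝ} (hm : Measurable ψ) (hi : Integrable ψ μ)
    {B : ℝ} (hB : ∀ x, |ψ x| ≤ B) (v : E) :
    ∫ x, (∫ s in Ioc (-L) L, ψ (x - s • v)) ^ 2 ∂μ
      = ∫ u : ℝ, max (2 * L - |u|) 0 * ∫ x, ψ x * ψ (x - u • v) ∂μ := by
  set χ : ℝ → ℝ := (Ioc (-L) L).indicator 1 with hχ
  have hχm : Measurable χ := measurable_one.indicator measurableSet_Ioc
  have hχi : Integrable χ := by
    refine (integrable_indicator_iff measurableSet_Ioc).2 ?_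
    exact integrableOn_const (by simp)
  have hχχ : Integrable (fun p : ℝ × ℝ => χ p.1 * χ (p.1 + p.2)) (volume.prod volume) := by
    exact (measurePreserving_prod_add (volume : Measure ℝ)
      (volume : Measure ℝ)).integrable_comp_of_integrable (hχi.mul_prod hχi)
  -- The integrand of the expanded square after substituting `t = s + u`, grouped as an integrable
  -- factor times a bounded one so that Fubini applies.
  set Φ : E × (ℝ × ℝ) → ℝ := fun q => (χ q.2.1 * χ (q.2.1 + q.2.2) * ψ (q.1 - q.2.1 • v)) *
    ψ (q.1 - q.2.1 • v - q.2.2 • v) with hΦ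
  have hΦi : Integrable Φ (μ.prod (volume.prod volume)) := by
    refine Integrable.mul_bdd (c := B) ?_ (Measurable.aestronglyMeasurable (by fun_prop))
      (.of_forall fun y => hB _)
    have hmeas : Measurable fun q : E × (ℝ × ℝ) =>
        χ q.2.1 * χ (q.2.1 + q.2.2) * ψ (q.1 - q.2.1 • v) := by fun_prop
    rw [integrable_prod_iff' hmeas.aestronglyMeasurable]
    refine ⟨.of_forall fun p =>
      (hi.comp_sub_right (p.1 • v)).const_mul (χ p.1 * χ (p.1 + p.2)), ?_⟩
    simp only [norm_mul, integral_const_mul]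
    have : ∀ s : ℝ, ∫ x, ‖ψ (x - s • v)‖ ∂μ = ∫ x, ‖ψ x‖ ∂μ := fun s =>
      integral_sub_right_eq_self (fun x => ‖ψ x‖) _
    simp only [this]
    simpa using hχχ.norm.mul_const _
  have h1 : ∀ x, (∫ s in Ioc (-L) L, ψ (x - s • v)) = ∫ s, χ s * ψ (x - s • v) := by
    intro x
    rw [← integral_indicator measurableSet_Ioc]
    refine integral_congr_ae (.of_forall fun s => ?_)
    simp [hχ, indicator_apply]
  have h2 : ∀ x, (∫ s, χ s * ψ (x - s • v)) ^ 2 = ∫ p : ℝ × ℝ, Φ (x, p) := by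
    intro x
    have ha : Integrable (fun s => χ s * ψ (x - s • v)) :=
      hχi.mul_bdd (c := B) (Measurable.aestronglyMeasurable (by fun_prop))
        (.of_forall fun y => hB _)
    have := (measurePreserving_prod_add (volume : Measure ℝ) (volume : Measure ℝ)).integral_comp'
      (f := MeasurableEquiv.shearAddRight ℝ)
      (fun p : ℝ × ℝ => (χ p.1 * ψ (x - p.1 • v)) * (χ p.2 * ψ (x - p.2 • v)))
    rw [sq, ← integral_prod_mul]
    refine this.symm.trans ?_
    refine integral_congr_ae (.of_forall fun p => ?_)
    have hp : MeasurableEquiv.shearAddRight ℝ p = (p.1, p.1 + p.2) := rfl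
    simp only [hΦ, hp, add_smul, sub_sub]
    ring
  simp only [h1, h2]
  rw [show (volume : Measure (ℝ × ℝ)) = volume.prod volume from rfl,
    integral_integral_swap (f := fun x p => Φ (x, p)) hΦi]
  -- Translating `x` by `s • v` leaves `s` only in the cutoffs, whose integral over `s` is the tent.
  have h3 : ∀ p : ℝ × ℝ, ∫ x, Φ (x, p) ∂μ
      = χ p.1 * χ (p.1 + p.2) * ∫ x, ψ x * ψ (x - p.2 • v) ∂μ := by
    intro p
    simp only [hΦ, mul_assoc, integral_const_mul]
    rw [integral_sub_right_eq_self (fun x => ψ x * ψ (x - p.2 • v))]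
  have h4 := hΦi.integral_prod_right
  simp only [h3] at h4 ⊢
  rw [integral_prod_symm _ h4]
  simp only [integral_mul_const]
  refine integral_congr_ae (.of_forall fun u => ?_)
  simp only
  rw [integral_indicator_mul_indicator_add]

end Correlation

/-! ### The averaged kernel on `ℝ³` -/

section Kernel

/-- The kernel of the operator `½ ∫_{𝕊²} L_n^* L_n dn`. -/
noncomputable def segmentKernel (L : ℝ) (y : E3) : ℝ := max (2 * L - ‖y‖) 0 / ‖y‖ ^ 2

theorem integrable_tent (L : ℝ) : Integrable fun u : ℝ => max (2 * L - |u|) 0 := by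
  refine Continuous.integrable_of_hasCompactSupport (by fun_prop) ?_
  refine HasCompactSupport.intro (isCompact_Icc (a := -(2 * L)) (b := 2 * L)) fun u hu => ?_
  rw [max_eq_right]
  by_contra! h
  exact hu (abs_le.1 (by linarith))

/-- The Jacobian `r²` of dimension three cancels the singularity `1 / r²` exactly, leaving the tent.
-/
theorem integrable_segmentKernel (L : ℝ) : Integrable (segmentKernel L) := by
  refine (integrable_fun_norm_addHaar (volume : Measure E3)
    (f := fun r => max (2 * L - r) 0 / r ^ 2)).2 ?_
  refine ((integrable_tent L).integrableOn (s := Ioi 0)).congr_fun (fun r hr => ?_)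
    measurableSet_Ioi
  have : r ≠ 0 := (mem_Ioi.1 hr).ne'
  simp only [finrank_euclideanSpace, Fintype.card_fin, Nat.add_one_sub_one, smul_eq_mul]
  rw [abs_of_pos (mem_Ioi.1 hr)]
  field_simp

theorem measurable_autocorrelation {ψ : E3 → ℝ} (hm : Measurable ψ) :
    Measurable fun y => ∫ x, ψ x * ψ (x - y) := by
  refine (StronglyMeasurable.integral_prod_right (ν := volume)
    (f := fun y x => ψ x * ψ (x - y)) ?_).measurable
  exact Measurable.stronglyMeasurable (by fun_prop)

theorem abs_autocorrelation_le {ψ : E3 → ℝ} (hi : Integrable ψ) {B : ℝ} (hB : ∀ x, |ψ x| ≤ B)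
    (y : E3) : |∫ x, ψ x * ψ (x - y)| ≤ B * ∫ x, |ψ x| := by
  rw [← integral_const_mul]
  refine abs_integral_le_integral_abs.trans ?_
  refine integral_mono_of_nonneg (.of_forall fun _ => abs_nonneg _) (hi.abs.const_mul B)
    (.of_forall fun x => ?_)
  simp only [abs_mul]
  rw [mul_comm]
  exact mul_le_mul_of_nonneg_right (hB _) (abs_nonneg _)

theorem integrable_tent_mul_autocorrelation (L : ℝ) {ψ : E3 → ℝ} (hm : Measurable ψ)
    (hi : Integrable ψ) {B : ℝ} (hB : ∀ x, |ψ x| ≤ B) :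
    Integrable (fun n : S2 => ∫ u : ℝ,
      max (2 * L - |u|) 0 * ∫ x, ψ x * ψ (x - u • (n : E3))) surf := by
  refine Integrable.integral_prod_left (ν := volume) (f := fun p : S2 × ℝ =>
    max (2 * L - |p.2|) 0 * ∫ x, ψ x * ψ (x - p.2 • (p.1 : E3))) ?_
  refine Integrable.mul_bdd (c := B * ∫ x, |ψ x|)
    ((integrable_tent L).comp_snd (surf : Measure S2)) ?_
    (.of_forall fun p => abs_autocorrelation_le hi hB _)
  exact ((measurable_autocorrelation hm).comp
    (f := fun p : S2 × ℝ => p.2 • (p.1 : E3)) (by fun_prop)).aestronglyMeasurable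

/-- The autocorrelation is even, so the integral over `u ∈ ℝ` is twice that over `u > 0`; `u • n`
then runs over `ℝ³` in polar coordinates, and the missing Jacobian `u²` becomes the denominator of
the kernel. -/
theorem integral_sphere_tent_mul_autocorrelation (L : ℝ) {ψ : E3 → ℝ} (hm : Measurable ψ)
    (hi : Integrable ψ) {B : ℝ} (hB : ∀ x, |ψ x| ≤ B) :
    ∫ n : S2, (∫ u : ℝ, max (2 * L - |u|) 0 * ∫ x, ψ x * ψ (x - u • (n : E3))) ∂surf
      = 2 * ∫ y, segmentKernel L y * ∫ x, ψ x * ψ (x - y) := by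
  have hKG : Integrable fun y => segmentKernel L y * ∫ x, ψ x * ψ (x - y) :=
    (integrable_segmentKernel L).mul_bdd (c := B * ∫ x, |ψ x|)
      (measurable_autocorrelation hm).aestronglyMeasurable
      (.of_forall fun p => abs_autocorrelation_le hi hB _)
  rw [integral_eq_integral_sphere_integral_Ioi hKG, ← integral_const_mul]
  refine integral_congr_ae (.of_forall fun n => ?_)
  simp only
  have habs : ∀ u : ℝ, max (2 * L - |u|) 0 * ∫ x, ψ x * ψ (x - u • (n : E3))
      = (fun r : ℝ => max (2 * L - r) 0 * ∫ x, ψ x * ψ (x - r • (n : E3))) |u| := by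
    intro u
    rcases abs_cases u with ⟨h, -⟩ | ⟨h, -⟩
    · simp only [h]
    · simp only [h]
      rw [neg_smul, integral_mul_translate_neg]
  simp only [habs]
  rw [integral_comp_abs (f := fun r : ℝ => max (2 * L - r) 0 * ∫ x, ψ x * ψ (x - r • (n : E3)))]
  congr 1
  refine setIntegral_congr_fun measurableSet_Ioi fun r hr => ?_
  have hr' : 0 < r := hr
  have hn : ‖r • (n : E3)‖ = r := by
    rw [norm_smul, norm_eq_of_mem_sphere, mul_one, Real.norm_eq_abs, abs_of_pos hr']
  simp only [finrank_euclideanSpace, Fintype.card_fin, Nat.add_one_sub_one, segmentKernel, hn]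
  field_simp

/-- With the `x` integral outermost, the inner one is a difference of two values of `K * f`, small
in sup norm by `abs_integral_mul_sub_le`; the remaining factor has `L¹` norm at most `2 ‖f‖₁`.
Absolute values are taken only after the swap, since the cancellation sits in the inner integral. -/
theorem integral_segmentKernel_mul_autocorrelation_le (L : ℝ) {f : E3 → ℝ} (hm : Measurable f)
    (hi : Integrable f) {M : ℝ} (hM : ∀ x, |f x| ≤ M) (h : E3) :
    ∫ y, segmentKernel L y * ∫ x, (f x - f (x + h)) * (f (x - y) - f (x - y + h))
      ≤ 2 * M * (∫ x, |f x|) * ∫ y, |segmentKernel L (y + h) - segmentKernel L y| := by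
  have hM0 : 0 ≤ M := (abs_nonneg _).trans (hM 0)
  set ω := ∫ y, |segmentKernel L (y + h) - segmentKernel L y| with hω
  have hω0 : 0 ≤ ω := integral_nonneg fun _ => abs_nonneg _
  have hih : Integrable fun x => f x - f (x + h) := hi.sub (hi.comp_add_right h)
  have hK := integrable_segmentKernel L
  have hB : ∀ x, |f x - f (x + h)| ≤ M + M := fun x =>
    (abs_sub _ _).trans (add_le_add (hM _) (hM _))
  have hprod : Integrable (fun p : E3 × E3 => (segmentKernel L p.1 * (f p.2 - f (p.2 + h))) *
      (f (p.2 - p.1) - f (p.2 - p.1 + h))) (volume.prod volume) :=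
    (hK.mul_prod hih).mul_bdd (c := M + M) (Measurable.aestronglyMeasurable (by fun_prop))
      (.of_forall fun p => hB _)
  have hsw : ∫ y, segmentKernel L y * ∫ x, (f x - f (x + h)) * (f (x - y) - f (x - y + h))
      = ∫ x, (f x - f (x + h)) * ∫ y, segmentKernel L y * (f (x - y) - f (x - y + h)) := by
    have := integral_integral_swap (f := fun y x => (segmentKernel L y * (f x - f (x + h))) *
      (f (x - y) - f (x - y + h))) hprod
    simp only [mul_assoc, integral_const_mul] at this
    rw [this]
    refine integral_congr_ae (.of_forall fun x => ?_)
    simp only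
    rw [← integral_const_mul]
    refine integral_congr_ae (.of_forall fun y => ?_)
    simp only
    ring
  have hbd : ∀ x, |∫ y, segmentKernel L y * (f (x - y) - f (x - y + h))| ≤ M * ω := by
    intro x
    have hint : ∀ z, Integrable fun y => segmentKernel L y * f (z - y) := fun z =>
      hK.mul_bdd (c := M) (Measurable.aestronglyMeasurable (by fun_prop)) (.of_forall fun p => hM _)
    have h1 : ∫ y, segmentKernel L y * (f (x - y) - f (x - y + h))
        = (∫ y, segmentKernel L y * f (x - y)) - ∫ y, segmentKernel L y * f (x + h - y) := by
      rw [← integral_sub (hint x) (hint (x + h))]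
      refine integral_congr_ae (.of_forall fun y => ?_)
      simp only [mul_sub, sub_add_eq_add_sub]
    rw [h1]
    exact abs_integral_mul_sub_le hK hm hM x h
  rw [hsw]
  calc _ ≤ ∫ x, (|f x| + |f (x + h)|) * (M * ω) := by
        refine (le_abs_self _).trans (abs_integral_le_integral_abs.trans ?_)
        refine integral_mono_of_nonneg (.of_forall fun _ => abs_nonneg _)
          ((hi.abs.add (hi.comp_add_right h).abs).mul_const (M * ω)) (.of_forall fun x => ?_)
        simp only [abs_mul]
        exact mul_le_mul (abs_sub _ _) (hbd x) (abs_nonneg _) (by positivity)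
    _ = _ := by
        rw [integral_mul_const, integral_add hi.abs (hi.comp_add_right h).abs,
          integral_add_right_eq_self (fun x => |f x|)]
        ring

theorem integrable_segmentIntegral (L : ℝ) {ψ : E3 → ℝ} (hm : Measurable ψ)
    (hi : Integrable ψ) (v : E3) : Integrable fun x => ∫ s in Ioc (-L) L, ψ (x - s • v) := by
  refine Integrable.integral_prod_left (ν := volume.restrict (Ioc (-L) L))
    (f := fun p : E3 × ℝ => ψ (p.1 - p.2 • v)) ?_
  rw [integrable_prod_iff' (Measurable.aestronglyMeasurable (by fun_prop))]
  refine ⟨.of_forall fun s => hi.comp_sub_right (s • v), ?_⟩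
  have : ∀ s : ℝ, ∫ x, ‖ψ (x - s • v)‖ = ∫ x, ‖ψ x‖ := fun s =>
    integral_sub_right_eq_self (fun x => ‖ψ x‖) _
  simp only [this]
  exact integrable_const _

theorem abs_segmentIntegral_le {L : ℝ} (hL : 0 ≤ L) {ψ : E3 → ℝ} {B : ℝ} (hB : ∀ x, |ψ x| ≤ B)
    (v x : E3) : |∫ s in Ioc (-L) L, ψ (x - s • v)| ≤ 2 * L * B := by
  have := norm_setIntegral_le_of_norm_le_const (μ := volume) (s := Ioc (-L) L) (C := B)
    (f := fun s => ψ (x - s • v)) (by simp) (fun s _ => hB _)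
  rw [Real.volume_real_Ioc_of_le (by linarith)] at this
  rw [← Real.norm_eq_abs]
  linarith

theorem lineInt_sub_lineInt_add {L : ℝ} (hL : 0 ≤ L) {f : E3 → ℝ} (hm : Measurable f) {M : ℝ}
    (hM : ∀ x, |f x| ≤ M) (n : S2) (x h : E3) :
    lineInt L n f x - lineInt L n f (x + h)
      = ∫ s in Ioc (-L) L, (f (x - s • (n : E3)) - f (x - s • (n : E3) + h)) := by
  have hint : ∀ z, IntegrableOn (fun s : ℝ => f (z - s • (n : E3))) (Ioc (-L) L) := fun z =>
    Measure.integrableOn_of_bounded (M := M) (by simp)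
      (Measurable.aestronglyMeasurable (by fun_prop)) (.of_forall fun s => hM _)
  simp only [lineInt]
  rw [intervalIntegral.integral_of_le (by linarith), intervalIntegral.integral_of_le (by linarith),
    ← integral_sub (hint x) (hint (x + h))]
  simp only [sub_add_eq_add_sub]

/-- The increments of the line integrals of `f` are controlled by the translates of
`segmentKernel` in `L¹`. -/
theorem lintegral_sphere_lintegral_sq_sub_le {L : ℝ} (hL : 0 ≤ L) {f : E3 → ℝ} (hm : Measurable f)
    (hi : Integrable f) {M : ℝ} (hM : ∀ x, |f x| ≤ M) (h : E3) :
    ∫⁻ n : S2, (∫⁻ x, ‖lineInt L n f x - lineInt L n f (x + h)‖ₑ ^ 2) ∂surf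
      ≤ ENNReal.ofReal (4 * M * (∫ x, |f x|) *
        ∫ y, |segmentKernel L (y + h) - segmentKernel L y|) := by
  set ψ : E3 → ℝ := fun x => f x - f (x + h) with hψ
  have hψm : Measurable ψ := by fun_prop
  have hψi : Integrable ψ := hi.sub (hi.comp_add_right h)
  have hB : ∀ x, |ψ x| ≤ M + M := fun x => (abs_sub _ _).trans (add_le_add (hM _) (hM _))
  have h1 : ∀ n : S2, ∫⁻ x, ‖lineInt L n f x - lineInt L n f (x + h)‖ₑ ^ 2
      = ENNReal.ofReal (∫ u : ℝ, max (2 * L - |u|) 0 * ∫ x, ψ x * ψ (x - u • (n : E3))) := by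
    intro n
    have hS := integrable_segmentIntegral L hψm hψi (n : E3)
    rw [← integral_sq_segment L hψm hψi hB, ofReal_integral_eq_lintegral_ofReal]
    · refine lintegral_congr fun x => ?_
      rw [lineInt_sub_lineInt_add hL hm hM, ← enorm_pow, Real.enorm_of_nonneg (sq_nonneg _)]
    · simp only [sq]
      exact hS.mul_bdd (c := 2 * L * (M + M)) hS.aestronglyMeasurable
        (.of_forall fun x => abs_segmentIntegral_le hL hB _ _)
    · exact .of_forall fun x => sq_nonneg _
  have h2 : ∀ n : S2, 0 ≤ ∫ u : ℝ, max (2 * L - |u|) 0 * ∫ x, ψ x * ψ (x - u • (n : E3)) := by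
    intro n
    rw [← integral_sq_segment L hψm hψi hB]
    exact integral_nonneg fun x => sq_nonneg _
  simp only [h1]
  rw [← ofReal_integral_eq_lintegral_ofReal (integrable_tent_mul_autocorrelation L hψm hψi hB)
    (.of_forall h2), integral_sphere_tent_mul_autocorrelation L hψm hψi hB]
  refine ENNReal.ofReal_le_ofReal ?_
  have := integral_segmentKernel_mul_autocorrelation_le L hm hi hM h
  simp only [hψ]
  linarith

end Kernel

/-! ### Kolmogorov–Riesz criterion in `L²` -/

section Compactness

theorem lintegral_sq_le {α : Type*} [MeasurableSpace α] (μ : Measure α) {f : α → ℝ≥0∞}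
    (hf : AEMeasurable f μ) : (∫⁻ a, f a ∂μ) ^ 2 ≤ μ univ * ∫⁻ a, f a ^ 2 ∂μ := by
  have h := ENNReal.lintegral_mul_le_Lp_mul_Lq μ Real.HolderConjugate.two_two hf
    (aemeasurable_const (b := (1 : ℝ≥0∞)))
  simp only [Pi.mul_apply, mul_one, ENNReal.rpow_two] at h
  refine (pow_le_pow_left' h 2).trans (le_of_eq ?_)
  rw [mul_pow, ← ENNReal.rpow_two, ← ENNReal.rpow_two, ← ENNReal.rpow_mul, ← ENNReal.rpow_mul]
  norm_num
  rw [mul_comm]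

theorem eLpNorm_two_sq {α : Type*} [MeasurableSpace α] (μ : Measure α) (f : α → ℝ) :
    eLpNorm f 2 μ ^ 2 = ∫⁻ a, ‖f a‖ₑ ^ 2 ∂μ := by
  have := eLpNorm_nnreal_pow_eq_lintegral (μ := μ) (f := f) (p := 2) two_ne_zero
  simpa using this

theorem eLpNorm_two_le_of_lintegral_sq_le {α : Type*} [MeasurableSpace α] {μ : Measure α}
    {f : α → ℝ} {c : ℝ} (hc : 0 ≤ c) (h : ∫⁻ a, ‖f a‖ₑ ^ 2 ∂μ ≤ ENNReal.ofReal (c ^ 2)) :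
    eLpNorm f 2 μ ≤ ENNReal.ofReal c := by
  rw [← eLpNorm_two_sq, ENNReal.ofReal_pow hc] at h
  exact (ENNReal.pow_le_pow_left_iff two_ne_zero).1 h

/-- The average of `f` over the ball of radius `r`. -/
noncomputable def ballAverage {E : Type*} [NormedAddCommGroup E] [MeasurableSpace E]
    (μ : Measure E) (r : ℝ) (f : E → ℝ) (x : E) : ℝ :=
  ∫ y, f (x - y) ∂(ProbabilityTheory.cond μ (ball 0 r))

theorem isProbabilityMeasure_cond_ball {E : Type*} [NormedAddCommGroup E]
    [NormedSpace ℝ E] [FiniteDimensional ℝ E] [MeasurableSpace E] {μ : Measure E}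
    [μ.IsAddHaarMeasure] {r : ℝ} (hr : 0 < r) :
    IsProbabilityMeasure (ProbabilityTheory.cond μ (ball (0 : E) r)) :=
  ProbabilityTheory.cond_isProbabilityMeasure_of_finite (measure_ball_pos μ 0 hr).ne'
    measure_ball_lt_top.ne

theorem ballAverage_eq_integral_mul {E : Type*} [NormedAddCommGroup E] [MeasurableSpace E]
    [BorelSpace E] {μ : Measure E} (r : ℝ) (f : E → ℝ) (x : E) :
    ballAverage μ r f x = ∫ y, (ball (0 : E) r).indicator (fun _ => (μ.real (ball 0 r))⁻¹) y
      * f (x - y) ∂μ := by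
  rw [ballAverage, ProbabilityTheory.cond, integral_smul_measure,
    ← integral_indicator measurableSet_ball, ← integral_smul]
  refine integral_congr_ae (.of_forall fun y => ?_)
  by_cases hy : y ∈ ball (0 : E) r <;> simp [hy, Measure.real]

/-- Arzelà–Ascoli on `K`, with the net chosen inside the family so that it is given by finitely many
indices. -/
theorem exists_finite_sup_dist_lt {E ι : Type*} [NormedAddCommGroup E] {K : Set E}
    (hK : IsCompact K) {F : ι → E → ℝ}
    {B : ℝ} (hB : ∀ j x, |F j x| ≤ B)
    (hF : ∀ ε > 0, ∃ δ > 0, ∀ j x h, ‖h‖ < δ → |F j x - F j (x + h)| < ε) {ε : ℝ} (hε : 0 < ε) :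
    ∃ t : Set ι, t.Finite ∧ ∀ j, ∃ i ∈ t, ∀ x ∈ K, |F j x - F i x| < ε := by
  have : CompactSpace K := isCompact_iff_compactSpace.1 hK
  have hF' : ∀ ε > 0, ∃ δ > 0, ∀ j x y, dist x y < δ → dist (F j x) (F j y) < ε := by
    intro ε hε
    obtain ⟨δ, hδ, H⟩ := hF ε hε
    refine ⟨δ, hδ, fun j x y hxy => ?_⟩
    rw [Real.dist_eq]
    have := H j x (y - x) (by rwa [← dist_eq_norm, dist_comm])
    rwa [add_sub_cancel] at this
  have hcont : ∀ j, Continuous fun x : K => F j x := by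
    intro j
    refine Metric.continuous_iff.2 fun b ε hε => ?_
    obtain ⟨δ, hδ, H⟩ := hF' ε hε
    exact ⟨δ, hδ, fun a hab => H j a b hab⟩
  set Φ : ι → BoundedContinuousFunction K ℝ := fun j =>
    BoundedContinuousFunction.mkOfCompact ⟨fun x : K => F j x, hcont j⟩ with hΦ
  have hcomp : IsCompact (closure (range Φ)) := by
    refine BoundedContinuousFunction.arzela_ascoli (Icc (-B) B) isCompact_Icc (range Φ) ?_ ?_
    · rintro _ x ⟨j, rfl⟩
      exact abs_le.1 (hB j x)
    · intro x
      refine Metric.equicontinuousAt_iff.2 fun ε hε => ?_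
      obtain ⟨δ, hδ, H⟩ := hF' ε hε
      refine ⟨δ, hδ, fun y hy => ?_⟩
      rintro ⟨_, j, rfl⟩
      exact H j x y (by rw [dist_comm]; exact hy)
  obtain ⟨s, hs, hsf, hcov⟩ := Metric.finite_approx_of_totallyBounded
    (hcomp.totallyBounded.subset subset_closure) ε hε
  choose g hg using fun y : s => hs y.2
  have : Finite s := hsf
  refine ⟨range g, finite_range g, fun j => ?_⟩
  obtain ⟨y, hy, hjy⟩ := mem_iUnion₂.1 (hcov (mem_range_self j))
  refine ⟨g ⟨y, hy⟩, mem_range_self _, fun x hx => ?_⟩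
  have h1 : dist (Φ j ⟨x, hx⟩) (y ⟨x, hx⟩) < ε :=
    (BoundedContinuousFunction.dist_coe_le_dist _).trans_lt hjy
  have h2 : Φ (g ⟨y, hy⟩) = y := hg ⟨y, hy⟩
  rw [← h2, Real.dist_eq] at h1
  exact h1

theorem abs_ballAverage_le {E : Type*} [NormedAddCommGroup E]
    [NormedSpace ℝ E] [FiniteDimensional ℝ E] [MeasurableSpace E] {μ : Measure E}
    [μ.IsAddHaarMeasure] {r : ℝ} (hr : 0 < r) {f : E → ℝ} {B : ℝ} (hB : ∀ x, |f x| ≤ B) (x : E) :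
    |ballAverage μ r f x| ≤ B := by
  have := isProbabilityMeasure_cond_ball (μ := μ) hr
  have := norm_integral_le_of_norm_le_const (μ := ProbabilityTheory.cond μ (ball 0 r)) (C := B)
    (f := fun y => f (x - y)) (.of_forall fun y => hB _)
  simpa [ballAverage] using this

variable {E : Type*} [NormedAddCommGroup E] [NormedSpace ℝ E] [FiniteDimensional ℝ E]
  [MeasurableSpace E] [BorelSpace E] {μ : Measure E} [μ.IsAddHaarMeasure]

theorem exists_abs_ballAverage_sub_lt {ι : Type*} (r : ℝ) {f : ι → E → ℝ}
    (hf : ∀ j, Measurable (f j)) {B : ℝ} (hB : ∀ j x, |f j x| ≤ B) {ε : ℝ} (hε : 0 < ε) :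
    ∃ δ > 0, ∀ j x h, ‖h‖ < δ → |ballAverage μ r (f j) x - ballAverage μ r (f j) (x + h)| < ε := by
  have hk : Integrable ((ball (0 : E) r).indicator fun _ => (μ.real (ball 0 r))⁻¹) μ :=
    (integrable_indicator_iff measurableSet_ball).2 (integrableOn_const measure_ball_lt_top.ne)
  obtain ⟨δ, hδ, H⟩ := exists_integral_abs_translate_sub_lt hk (ε := ε / (|B| + 1)) (by positivity)
  refine ⟨δ, hδ, fun j x h hh => ?_⟩
  simp only [ballAverage_eq_integral_mul]
  -- The sign of `B` is unknown when `ι` is empty; `|B| + 1` is a positive bound in every case.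
  refine (abs_integral_mul_sub_le hk (hf j) (fun x => (hB j x).trans
    ((le_abs_self B).trans (lt_add_one _).le)) x h).trans_lt ?_
  have := H h hh
  rw [lt_div_iff₀ (by positivity)] at this
  linarith

/-- Cauchy–Schwarz for the averaging probability measure, then Tonelli: the squared error is at most
an average of squared translation increments, each bounded by `c`. -/
theorem lintegral_sub_ballAverage_sq_le (ν : Measure E) [SFinite ν] {r : ℝ} (hr : 0 < r)
    {f : E → ℝ} (hf : Measurable f)
    {B : ℝ} (hB : ∀ x, |f x| ≤ B) {c : ℝ≥0∞}
    (hc : ∀ h : E, ‖h‖ < r → ∫⁻ x, ‖f x - f (x + h)‖ₑ ^ 2 ∂ν ≤ c) :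
    ∫⁻ x, ‖f x - ballAverage μ r f x‖ₑ ^ 2 ∂ν ≤ c := by
  have := isProbabilityMeasure_cond_ball (μ := μ) hr
  set ρ := ProbabilityTheory.cond μ (ball (0 : E) r) with hρ
  have hpt : ∀ x, ‖f x - ballAverage μ r f x‖ₑ ^ 2 ≤ ∫⁻ y, ‖f x - f (x - y)‖ₑ ^ 2 ∂ρ := by
    intro x
    have hint : Integrable (fun y => f (x - y)) ρ :=
      .of_bound (Measurable.aestronglyMeasurable (by fun_prop)) B (.of_forall fun y => hB _)
    have h1 : f x - ballAverage μ r f x = ∫ y, (f x - f (x - y)) ∂ρ := by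
      rw [integral_sub (integrable_const _) hint]
      simp [ballAverage, hρ]
    rw [h1]
    calc _ ≤ (∫⁻ y, ‖f x - f (x - y)‖ₑ ∂ρ) ^ 2 :=
          pow_le_pow_left' (enorm_integral_le_lintegral_enorm _) 2
      _ ≤ _ := by
          refine (lintegral_sq_le ρ (Measurable.aemeasurable (by fun_prop))).trans ?_
          simp
  calc _ ≤ ∫⁻ x, ∫⁻ y, ‖f x - f (x - y)‖ₑ ^ 2 ∂ρ ∂ν := lintegral_mono hpt
    _ = ∫⁻ y, ∫⁻ x, ‖f x - f (x - y)‖ₑ ^ 2 ∂ν ∂ρ :=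
        lintegral_lintegral_swap (Measurable.aemeasurable (by fun_prop))
    _ ≤ ∫⁻ y, c ∂ρ := by
        refine lintegral_mono_ae ?_
        have hmem : ∀ᵐ y ∂ρ, y ∈ ball (0 : E) r :=
          ProbabilityTheory.ae_cond_mem measurableSet_ball
        filter_upwards [hmem] with y hy
        simpa [sub_eq_add_neg] using hc (-y) (by simpa using hy)
    _ = c := by simp

theorem measurable_ballAverage {r : ℝ} (hr : 0 < r) {f : E → ℝ} (hf : Measurable f) :
    Measurable (ballAverage μ r f) := by
  have := isProbabilityMeasure_cond_ball (μ := μ) hr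
  refine (StronglyMeasurable.integral_prod_right (ν := ProbabilityTheory.cond μ (ball 0 r))
    (f := fun x y => f (x - y)) ?_).measurable
  exact Measurable.stronglyMeasurable (by fun_prop)

/-- The sufficiency part of the Kolmogorov–Riesz theorem in `L²`, for bounded families on a
compact set. -/
theorem exists_finite_eLpNorm_sub_lt {ι : Type*} {K : Set E} (hK : IsCompact K) {f : ι → E → ℝ}
    (hf : ∀ j, Measurable (f j)) {B : ℝ} (hB : ∀ j x, |f j x| ≤ B)
    (H : ∀ ε : ℝ, 0 < ε → ∃ h₀ : ℝ, 0 < h₀ ∧ ∀ j, ∀ h : E, ‖h‖ < h₀ →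
      ∫⁻ x, ‖f j x - f j (x + h)‖ₑ ^ 2 ∂(μ.restrict K) ≤ ENNReal.ofReal ε) {ε : ℝ} (hε : 0 < ε) :
    ∃ t : Set ι, t.Finite ∧ ∀ j, ∃ i ∈ t,
      eLpNorm (f j - f i) 2 (μ.restrict K) < ENNReal.ofReal ε := by
  -- Three errors of at most `ε / 4` are added below, which leaves room for the strict inequality.
  obtain ⟨r, hr, hr'⟩ := H ((ε / 4) ^ 2) (by positivity)
  set V := μ.real K
  have hV : 0 ≤ V := measureReal_nonneg
  -- A sup distance `ε / 4 / (V + 1)` on `K` gives `L²` distance at most `ε / 4`, because `V ≤ (V +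
  -- 1)²`; the `+ 1` covers `V = 0`.
  obtain ⟨t, ht, hcov⟩ := exists_finite_sup_dist_lt hK (F := fun j => ballAverage μ r (f j))
    (fun j x => abs_ballAverage_le hr (hB j) x)
    (fun ε hε => exists_abs_ballAverage_sub_lt r hf hB hε) (ε := ε / 4 / (V + 1)) (by positivity)
  refine ⟨t, ht, fun j => ?_⟩
  obtain ⟨i, hi, hij⟩ := hcov j
  refine ⟨i, hi, ?_⟩
  have hav : ∀ j, eLpNorm (f j - ballAverage μ r (f j)) 2 (μ.restrict K)
      ≤ ENNReal.ofReal (ε / 4) := fun j =>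
    eLpNorm_two_le_of_lintegral_sq_le (by positivity)
      (lintegral_sub_ballAverage_sq_le _ hr (hf j) (hB j) (hr' j))
  have hdiff : eLpNorm (ballAverage μ r (f j) - ballAverage μ r (f i)) 2 (μ.restrict K)
      ≤ ENNReal.ofReal (ε / 4) := by
    refine eLpNorm_two_le_of_lintegral_sq_le (by positivity) ?_
    calc _ ≤ ∫⁻ x in K, ENNReal.ofReal (ε / 4 / (V + 1)) ^ 2 ∂μ := by
          refine setLIntegral_mono' hK.measurableSet fun x hx => ?_
          refine pow_le_pow_left' ?_ 2
          rw [Real.enorm_eq_ofReal_abs]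
          exact ENNReal.ofReal_le_ofReal (hij x hx).le
      _ ≤ _ := by
          rw [setLIntegral_const, ← ofReal_measureReal hK.measure_lt_top.ne,
            ← ENNReal.ofReal_pow (by positivity), ← ENNReal.ofReal_mul (by positivity)]
          refine ENNReal.ofReal_le_ofReal ?_
          change (ε / 4 / (V + 1)) ^ 2 * V ≤ (ε / 4) ^ 2
          rw [div_pow, div_mul_eq_mul_div, div_le_iff₀ (by positivity)]
          gcongr
          nlinarith
  have hm : ∀ j, AEStronglyMeasurable (f j - ballAverage μ r (f j)) (μ.restrict K) := fun j =>
    ((hf j).sub (measurable_ballAverage hr (hf j))).aestronglyMeasurable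
  have hm' : AEStronglyMeasurable (ballAverage μ r (f j) - ballAverage μ r (f i))
      (μ.restrict K) := ((measurable_ballAverage hr (hf j)).sub
    (measurable_ballAverage hr (hf i))).aestronglyMeasurable
  have hsplit : f j - f i = ((f j - ballAverage μ r (f j))
      + (ballAverage μ r (f j) - ballAverage μ r (f i))) - (f i - ballAverage μ r (f i)) := by
    abel
  rw [hsplit]
  calc _ ≤ ENNReal.ofReal (ε / 4) + ENNReal.ofReal (ε / 4) + ENNReal.ofReal (ε / 4) := by
        refine (eLpNorm_sub_le ((hm j).add hm') (hm i) (by norm_num)).trans ?_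
        refine add_le_add ((eLpNorm_add_le (hm j) hm' (by norm_num)).trans ?_) (hav i)
        exact add_le_add (hav j) hdiff
    _ < _ := by
        rw [← ENNReal.ofReal_add (by positivity) (by positivity),
          ← ENNReal.ofReal_add (by positivity) (by positivity), ENNReal.ofReal_lt_ofReal_iff hε]
        linarith

theorem isCompact_closure_range_toLp {α ι : Type*} [MeasurableSpace α] {μ : Measure α}
    {f : ι → α → ℝ} (hf : ∀ j, MemLp (f j) 2 μ)
    (H : ∀ ε : ℝ, 0 < ε → ∃ t : Set ι, t.Finite ∧ ∀ j, ∃ i ∈ t,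
      eLpNorm (f j - f i) 2 μ < ENNReal.ofReal ε) :
    IsCompact (closure (range fun j => (hf j).toLp (f j))) := by
  refine TotallyBounded.isCompact_of_isClosed (TotallyBounded.closure ?_) isClosed_closure
  refine Metric.totallyBounded_iff.2 fun ε hε => ?_
  obtain ⟨t, ht, hcov⟩ := H ε hε
  refine ⟨(fun j => (hf j).toLp (f j)) '' t, ht.image _, ?_⟩
  rintro _ ⟨j, rfl⟩
  obtain ⟨i, hi, hij⟩ := hcov j
  refine mem_iUnion₂.2 ⟨_, mem_image_of_mem _ hi, ?_⟩
  rw [mem_ball, ← edist_lt_ofReal, Lp.edist_toLp_toLp]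
  exact hij

end Compactness

/-! ### Bounded Borel representatives and independence of null sets -/

section Representative

theorem isCompact_cube (L : ℝ) : IsCompact (cube L) := by
  have h : cube L = (EuclideanSpace.equiv (Fin 3) ℝ) ⁻¹' (Set.pi univ fun _ => Icc (-L) L) := by
    ext x
    exact ⟨fun h i _ => h i, fun h i => h i (mem_univ i)⟩
  rw [h]
  exact ((EuclideanSpace.equiv (Fin 3) ℝ).toHomeomorph.isCompact_preimage).2
    (isCompact_univ_pi fun _ => isCompact_Icc)

theorem IsCubePeriodic.add_lattice {L : ℝ} {φ : E3 → ℝ} (hφ : IsCubePeriodic L φ)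
    (k : Fin 3 → ℤ) (x : E3) :
    φ (x + ∑ i, k i • EuclideanSpace.single i (2 * L)) = φ x := by
  have h : ∀ i, Function.Periodic φ (k i • EuclideanSpace.single i (2 * L)) := fun i =>
    (hφ i).zsmul (k i)
  rw [Fin.sum_univ_three]
  exact (((h 0).add_period (h 1)).add_period (h 2)) x

theorem exists_add_lattice_mem_cube {L : ℝ} (hL : 0 < L) (x : E3) :
    ∃ k : Fin 3 → ℤ, x + ∑ i, k i • (EuclideanSpace.single i (2 * L) : E3) ∈ cube L := by
  refine ⟨fun i => -⌊(x i + L) / (2 * L)⌋, fun j => ?_⟩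
  have h1 := Int.floor_le ((x j + L) / (2 * L))
  have h2 := Int.lt_floor_add_one ((x j + L) / (2 * L))
  rw [le_div_iff₀ (by positivity)] at h1
  rw [div_lt_iff₀ (by positivity)] at h2
  have h3 : (x + ∑ i, (-⌊(x i + L) / (2 * L)⌋) • (EuclideanSpace.single i (2 * L) : E3)) j
      = x j - ⌊(x j + L) / (2 * L)⌋ * (2 * L) := by
    fin_cases j <;> simp [Fin.sum_univ_three, sub_eq_add_neg]
  rw [h3]
  constructor <;> linarith

/-- A function invariant under countably many translations moving every point into `A`, and bounded
on `A`, agrees almost everywhere with a bounded Borel function. -/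
theorem exists_measurable_ae_eq_of_translates {ι : Type*} [Countable ι] {A : Set E3}
    (hA : MeasurableSet A) (v : ι → E3) (hcov : ∀ x, ∃ k, x + v k ∈ A) {M : ℝ≥0} {φ : E3 → ℝ}
    (hφ : ∀ k x, φ (x + v k) = φ x) (hmem : AEMeasurable φ (volume.restrict A))
    (hM : eLpNorm φ ∞ (volume.restrict A) ≤ M) :
    ∃ g : E3 → ℝ, Measurable g ∧ (∀ x, |g x| ≤ M) ∧ φ =ᵐ[volume] g := by
  have hcov' : ⋃ k, (fun x => x + v k) ⁻¹' A = univ :=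
    eq_univ_of_forall fun x => mem_iUnion.2 (hcov x)
  have hmp : ∀ k, MeasurePreserving (fun x => x + v k)
      (volume.restrict ((fun x => x + v k) ⁻¹' A)) (volume.restrict A) := fun k =>
    (measurePreserving_add_right volume _).restrict_preimage hA
  have hper : ∀ k, φ ∘ (fun x => x + v k) = φ := fun k => funext fun x => hφ k x
  have haem : AEMeasurable φ volume := by
    rw [← Measure.restrict_univ (μ := volume), ← hcov', aemeasurable_iUnion_iff]
    intro k
    have := hmem.comp_quasiMeasurePreserving (hmp k).quasiMeasurePreserving
    rwa [hper] at this
  have hA_bd : ∀ᵐ x ∂(volume.restrict A), |φ x| ≤ M := by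
    rw [eLpNorm_exponent_top] at hM
    filter_upwards [ae_le_eLpNormEssSup (f := φ) (μ := volume.restrict A)] with x hx
    have := hx.trans hM
    rw [enorm_le_coe] at this
    exact this
  have hbd : ∀ᵐ x : E3, |φ x| ≤ M := by
    rw [← Measure.restrict_univ (μ := volume), ← hcov', ae_restrict_iUnion_iff]
    intro k
    filter_upwards [(hmp k).quasiMeasurePreserving.ae hA_bd] with x hx
    rwa [hφ k x] at hx
  -- Truncation makes the bound hold everywhere and changes the measurable representative only on a
  -- null set.
  refine ⟨fun x => max (-M) (min (haem.mk φ x) M),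
    measurable_const.max (haem.measurable_mk.min measurable_const), fun x => ?_, ?_⟩
  · refine abs_le.2 ⟨le_max_left _ _, max_le ?_ (min_le_right _ _)⟩
    exact (neg_nonpos.2 M.coe_nonneg).trans M.coe_nonneg
  · filter_upwards [haem.ae_eq_mk, hbd] with x hx hx'
    rw [← hx, min_eq_left (abs_le.1 hx').2, max_eq_right (abs_le.1 hx').1]

theorem IsCubePeriodic.exists_measurable_ae_eq {L : ℝ} (hL : 0 < L) {M : ℝ≥0} {φ : E3 → ℝ}
    (hφ : IsCubePeriodic L φ) (hmem : MemLp φ ∞ (cubeMeasure L))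
    (hM : eLpNorm φ ∞ (cubeMeasure L) ≤ M) :
    ∃ g : E3 → ℝ, Measurable g ∧ (∀ x, |g x| ≤ M) ∧ φ =ᵐ[volume] g :=
  exists_measurable_ae_eq_of_translates (isCompact_cube L).measurableSet
    (fun k : Fin 3 → ℤ => ∑ i, k i • EuclideanSpace.single i (2 * L))
    (exists_add_lattice_mem_cube hL) hφ.add_lattice hmem.aestronglyMeasurable.aemeasurable hM

/-- For each fixed `p` the exceptional `x` form a translate of a null set, and Fubini exchanges the
quantifiers. This is why `φ` may be replaced by its representative along lines, which are themselves
null. -/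
theorem ae_ae_sub {T : Type*} [MeasurableSpace T] (τ : Measure T) [SFinite τ] {c : T → E3}
    (hc : Measurable c) {P : E3 → Prop} (hP : ∀ᵐ x, P x) : ∀ᵐ x : E3, ∀ᵐ p ∂τ, P (x - c p) := by
  obtain ⟨s, hs, hsm, hs0⟩ := exists_measurable_superset_of_null (ae_iff.1 hP)
  have h : ∀ᵐ p ∂τ, ∀ᵐ x : E3, x - c p ∉ s := .of_forall fun p =>
    (measurePreserving_sub_right volume (c p)).quasiMeasurePreserving.ae
      (measure_eq_zero_iff_ae_notMem.1 hs0)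
  have hmeas : MeasurableSet {q : T × E3 | q.2 - c q.1 ∉ s} :=
    (measurableSet_preimage (by fun_prop : Measurable fun q : T × E3 => q.2 - c q.1) hsm).compl
  rw [Measure.ae_ae_comm hmeas] at h
  filter_upwards [h] with x hx
  filter_upwards [hx] with p hp
  by_contra hc
  exact hp (hs hc)

variable {L : ℝ} {φ g : E3 → ℝ}

theorem ae_intervalIntegrable_of_ae_eq (h : φ =ᵐ[volume] g) (hg : Measurable g) {M : ℝ}
    (hM : ∀ x, |g x| ≤ M) (n : S2) :
    ∀ᵐ x : E3, IntervalIntegrable (fun t : ℝ => φ (x - t • (n : E3))) volume (-L) L := by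
  filter_upwards [ae_ae_sub (volume : Measure ℝ) (c := fun t => t • (n : E3)) (by fun_prop) h]
    with x hx
  have hi : IntervalIntegrable (fun t : ℝ => g (x - t • (n : E3))) volume (-L) L := by
    rw [intervalIntegrable_iff]
    exact Measure.integrableOn_of_bounded (M := M) (by simp [uIoc])
      (Measurable.aestronglyMeasurable (by fun_prop)) (.of_forall fun s => hM _)
  refine hi.congr_ae (ae_restrict_of_ae ?_)
  filter_upwards [hx] with t ht using ht.symm

theorem ae_ae_lineInt_eq (h : φ =ᵐ[volume] g) :
    ∀ᵐ x : E3, ∀ᵐ n ∂surf, lineInt L n φ x = lineInt L n g x := by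
  filter_upwards [ae_ae_sub ((surf : Measure S2).prod (volume : Measure ℝ))
    (c := fun p : S2 × ℝ => p.2 • (p.1 : E3)) (by fun_prop) h] with x hx
  filter_upwards [Measure.ae_ae_of_ae_prod hx] with n hn
  refine intervalIntegral.integral_congr_ae ?_
  filter_upwards [hn] with t ht _ using ht

theorem sphereInt_ae_eq (h : φ =ᵐ[volume] g) (m : ℕ) :
    sphereInt L m φ =ᵐ[volume] sphereInt L m g := by
  filter_upwards [ae_ae_lineInt_eq (L := L) h] with x hx
  refine integral_congr_ae ?_
  filter_upwards [hx] with n hn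
  rw [hn]

/-! ### Bounds for `L_n` and `T_m`, and their increments on the cube -/

theorem measurable_lineInt (hL : 0 ≤ L) (hg : Measurable g) :
    Measurable fun p : E3 × S2 => lineInt L p.2 g p.1 := by
  have : (fun p : E3 × S2 => lineInt L p.2 g p.1)
      = fun p : E3 × S2 => ∫ t in Ioc (-L) L, g (p.1 - t • (p.2 : E3)) := by
    ext p
    exact intervalIntegral.integral_of_le (by linarith)
  rw [this]
  refine (StronglyMeasurable.integral_prod_right (ν := volume.restrict (Ioc (-L) L))
    (f := fun (p : E3 × S2) (t : ℝ) => g (p.1 - t • (p.2 : E3))) ?_).measurable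
  exact Measurable.stronglyMeasurable (by fun_prop)

theorem abs_lineInt_le (hL : 0 ≤ L) {M : ℝ} (hM : ∀ x, |g x| ≤ M) (n : S2) (x : E3) :
    |lineInt L n g x| ≤ 2 * L * M := by
  rw [lineInt, intervalIntegral.integral_of_le (by linarith)]
  exact abs_segmentIntegral_le hL hM _ _

theorem integrable_lineInt_pow (hL : 0 ≤ L) (hg : Measurable g) {M : ℝ} (hM : ∀ x, |g x| ≤ M)
    (m : ℕ) (x : E3) : Integrable (fun n : S2 => lineInt L n g x ^ m) surf := by
  refine .of_bound (((measurable_lineInt hL hg).comp (measurable_prodMk_left (x := x))).pow_const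
    m).aestronglyMeasurable ((2 * L * M) ^ m) (.of_forall fun n => ?_)
  rw [norm_pow]
  exact pow_le_pow_left₀ (norm_nonneg _) (abs_lineInt_le hL hM n x) m

theorem measurable_sphereInt (hL : 0 ≤ L) (hg : Measurable g) (m : ℕ) :
    Measurable (sphereInt L m g) := by
  refine (StronglyMeasurable.integral_prod_right (ν := (surf : Measure S2))
    (f := fun (x : E3) (n : S2) => lineInt L n g x ^ m) ?_).measurable
  exact ((measurable_lineInt hL hg).pow_const m).stronglyMeasurable

theorem abs_sphereInt_le (hL : 0 ≤ L) {M : ℝ} (hM : ∀ x, |g x| ≤ M) (m : ℕ) (x : E3) :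
    |sphereInt L m g x| ≤ (2 * L * M) ^ m * (surf : Measure S2).real univ := by
  refine norm_integral_le_of_norm_le_const (μ := (surf : Measure S2))
    (f := fun n => lineInt L n g x ^ m) (.of_forall fun n => ?_)
  rw [norm_pow]
  exact pow_le_pow_left₀ (norm_nonneg _) (abs_lineInt_le hL hM n x) m

theorem enorm_pow_sub_pow_le {a b B : ℝ} (ha : |a| ≤ B) (hb : |b| ≤ B) (m : ℕ) :
    ‖a ^ m - b ^ m‖ₑ ≤ ENNReal.ofReal (m * B ^ (m - 1)) * ‖a - b‖ₑ := by
  have hB : 0 ≤ B := (abs_nonneg a).trans ha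
  rw [Real.enorm_eq_ofReal_abs, Real.enorm_eq_ofReal_abs, ← ENNReal.ofReal_mul (by positivity)]
  -- For `m = 0` the truncated exponent `m - 1` is harmless: the factor `m` vanishes, as does the
  -- left side.
  refine ENNReal.ofReal_le_ofReal ((abs_pow_sub_pow_le a b m).trans ?_)
  rw [mul_assoc, mul_comm |a - b|]
  have : max |a| |b| ≤ B := max_le ha hb
  gcongr

theorem enorm_sphereInt_sub_sq_le (hL : 0 ≤ L) (hg : Measurable g) {M : ℝ} (hM : ∀ x, |g x| ≤ M)
    (m : ℕ) (x y : E3) :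
    ‖sphereInt L m g x - sphereInt L m g y‖ₑ ^ 2
      ≤ ENNReal.ofReal (m * (2 * L * M) ^ (m - 1)) ^ 2 * (surf : Measure S2) univ *
        ∫⁻ n : S2, ‖lineInt L n g x - lineInt L n g y‖ₑ ^ 2 ∂surf := by
  have hmeas : ∀ z, Measurable fun n : S2 => lineInt L n g z := fun z =>
    (measurable_lineInt hL hg).comp (measurable_prodMk_left (x := z))
  have h1 : ‖sphereInt L m g x - sphereInt L m g y‖ₑ
      ≤ ENNReal.ofReal (m * (2 * L * M) ^ (m - 1)) *
        ∫⁻ n : S2, ‖lineInt L n g x - lineInt L n g y‖ₑ ∂surf := by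
    rw [sphereInt, sphereInt, ← integral_sub (integrable_lineInt_pow hL hg hM m x)
      (integrable_lineInt_pow hL hg hM m y), ← lintegral_const_mul' _ _ ENNReal.ofReal_ne_top]
    refine (enorm_integral_le_lintegral_enorm _).trans (lintegral_mono fun n => ?_)
    exact enorm_pow_sub_pow_le (abs_lineInt_le hL hM n x) (abs_lineInt_le hL hM n y) m
  refine (pow_le_pow_left' h1 2).trans ?_
  rw [mul_pow, mul_assoc (ENNReal.ofReal _ ^ 2)]
  exact mul_le_mul_right (lintegral_sq_le surf ((hmeas x).sub (hmeas y)).enorm.aemeasurable) _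

theorem lintegral_lineInt_sub_congr (h : φ =ᵐ[volume] g) (s : E3) :
    ∫⁻ x, ∫⁻ n : S2, ‖lineInt L n φ x - lineInt L n φ (x + s)‖ₑ ^ 2 ∂surf ∂(cubeMeasure L)
      = ∫⁻ x, ∫⁻ n : S2, ‖lineInt L n g x - lineInt L n g (x + s)‖ₑ ^ 2 ∂surf
        ∂(cubeMeasure L) := by
  have h1 := ae_ae_lineInt_eq (L := L) h
  have h2 := (measurePreserving_add_right (volume : Measure E3) s).quasiMeasurePreserving.ae h1
  refine lintegral_congr_ae (ae_restrict_of_ae ?_)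
  filter_upwards [h1, h2] with x hx hx'
  refine lintegral_congr_ae ?_
  filter_upwards [hx, hx'] with n hn hn'
  rw [hn, hn']

theorem lintegral_sphereInt_sub_congr (h : φ =ᵐ[volume] g) (m : ℕ) (s : E3) :
    ∫⁻ x, ‖sphereInt L m φ x - sphereInt L m φ (x + s)‖ₑ ^ 2 ∂(cubeMeasure L)
      = ∫⁻ x, ‖sphereInt L m g x - sphereInt L m g (x + s)‖ₑ ^ 2 ∂(cubeMeasure L) := by
  have h1 := sphereInt_ae_eq (L := L) h m
  have h2 := (measurePreserving_add_right (volume : Measure E3) s).quasiMeasurePreserving.ae h1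
  refine lintegral_congr_ae (ae_restrict_of_ae ?_)
  filter_upwards [h1, h2] with x hx hx'
  rw [hx, hx']

/-- The whole-space estimate needs an integrable function, so `g` is cut off outside a ball. The
cutoff is invisible to `L_n` at points of the cube and their translates by `‖h‖ ≤ 1`, and its `L¹`
norm is controlled by `M` and the volume of the ball. -/
theorem exists_lintegral_lineInt_sub_sq_le (hL : 0 ≤ L) {M : ℝ} (hM0 : 0 ≤ M) :
    ∃ D : ℝ, 0 ≤ D ∧ ∀ g : E3 → ℝ, Measurable g → (∀ x, |g x| ≤ M) → ∀ h : E3, ‖h‖ ≤ 1 →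
      ∫⁻ x, ∫⁻ n : S2, ‖lineInt L n g x - lineInt L n g (x + h)‖ₑ ^ 2 ∂surf ∂(cubeMeasure L)
        ≤ ENNReal.ofReal (D * ∫ y, |segmentKernel L (y + h) - segmentKernel L y|) := by
  obtain ⟨R, hR⟩ := (isCompact_cube L).isBounded.subset_closedBall 0
  -- The cube lies within radius `R`, the shift `h` adds at most `1`, and the segment adds at most
  -- `L`.
  set S : Set E3 := closedBall 0 (R + 1 + L) with hS
  refine ⟨4 * M * (M * volume.real S), by positivity, fun g hg hM h hh => ?_⟩
  set f : E3 → ℝ := S.indicator g with hf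
  have hfm : Measurable f := hg.indicator measurableSet_closedBall
  have hfM : ∀ x, |f x| ≤ M := by
    intro x
    by_cases hx : x ∈ S <;> simp [hf, hx, hM, hM0]
  have hSfin : volume S ≠ ∞ := measure_closedBall_lt_top.ne
  have hfi : Integrable f := (integrable_indicator_iff measurableSet_closedBall).2
    (Measure.integrableOn_of_bounded (M := M) hSfin hg.aestronglyMeasurable
      (.of_forall fun x => hM x))
  have hf1 : ∫ x, |f x| ≤ M * volume.real S := by
    have h1 : (fun x => |f x|) = S.indicator fun x => |g x| := by
      ext x
      by_cases hx : x ∈ S <;> simp [hf, hx]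
    rw [h1, integral_indicator measurableSet_closedBall]
    have := norm_setIntegral_le_of_norm_le_const (μ := volume) (s := S) (C := M)
      (f := fun x => |g x|) hSfin.lt_top (fun x _ => by simpa using hM x)
    exact (le_abs_self _).trans this
  have hloc : ∀ (n : S2) (x : E3), ‖x‖ ≤ R + 1 → lineInt L n g x = lineInt L n f x := by
    intro n x hx
    refine intervalIntegral.integral_congr fun t ht => ?_
    have ht' : |t| ≤ L := by
      rw [uIcc_of_le (by linarith)] at ht
      exact abs_le.2 ht
    have : x - t • (n : E3) ∈ S := by
      rw [hS, mem_closedBall_zero_iff]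
      refine (norm_sub_le _ _).trans ?_
      rw [norm_smul, norm_eq_of_mem_sphere, mul_one, Real.norm_eq_abs]
      exact add_le_add hx ht'
    simp [hf, this]
  have hω : 0 ≤ ∫ y, |segmentKernel L (y + h) - segmentKernel L y| :=
    integral_nonneg fun _ => abs_nonneg _
  calc _ = ∫⁻ x, ∫⁻ n : S2, ‖lineInt L n f x - lineInt L n f (x + h)‖ₑ ^ 2 ∂surf
        ∂(cubeMeasure L) := by
        refine setLIntegral_congr_fun (isCompact_cube L).measurableSet fun x hx => ?_
        have hxR : ‖x‖ ≤ R := mem_closedBall_zero_iff.1 (hR hx)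
        refine lintegral_congr fun n => ?_
        rw [hloc n x (by linarith), hloc n (x + h) ((norm_add_le _ _).trans (by linarith))]
    _ ≤ ∫⁻ x, ∫⁻ n : S2, ‖lineInt L n f x - lineInt L n f (x + h)‖ₑ ^ 2 ∂surf :=
        lintegral_mono' Measure.restrict_le_self le_rfl
    _ = ∫⁻ n : S2, (∫⁻ x, ‖lineInt L n f x - lineInt L n f (x + h)‖ₑ ^ 2) ∂surf := by
        refine lintegral_lintegral_swap (Measurable.aemeasurable ?_)
        have h1 := measurable_lineInt hL hfm
        have h2 : Measurable fun p : E3 × S2 => lineInt L p.2 f (p.1 + h) :=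
          h1.comp (f := fun p : E3 × S2 => (p.1 + h, p.2)) (by fun_prop)
        exact (h1.sub h2).enorm.pow_const 2
    _ ≤ _ := lintegral_sphere_lintegral_sq_sub_le hL hfm hfi hfM h
    _ ≤ _ := by
        refine ENNReal.ofReal_le_ofReal ?_
        gcongr

/-- The mean square over all directions of the increments of the line integrals is small,
uniformly over all functions bounded by `M`. -/
theorem exists_lintegral_lineInt_sub_sq_lt (hL : 0 ≤ L) {M : ℝ} (hM0 : 0 ≤ M) (C : ℝ≥0) {ε : ℝ}
    (hε : 0 < ε) : ∃ h₀ : ℝ, 0 < h₀ ∧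
      ∀ g : E3 → ℝ, Measurable g → (∀ x, |g x| ≤ M) → ∀ h : E3, ‖h‖ < h₀ →
      C * (∫⁻ x, ∫⁻ n : S2, ‖lineInt L n g x - lineInt L n g (x + h)‖ₑ ^ 2 ∂surf
        ∂(cubeMeasure L)) < ENNReal.ofReal ε := by
  obtain ⟨D, hD, H⟩ := exists_lintegral_lineInt_sub_sq_le hL hM0
  obtain ⟨δ, hδ, Hδ⟩ := exists_integral_abs_translate_sub_lt (integrable_segmentKernel L)
    (ε := ε / (C * D + 1)) (by positivity)
  refine ⟨min δ 1, lt_min hδ one_pos, fun g hg hM h hh => ?_⟩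
  have h1 := H g hg hM h (hh.le.trans (min_le_right _ _))
  have h2 := Hδ h (hh.trans_le (min_le_left _ _))
  have hω : 0 ≤ ∫ y, |segmentKernel L (y + h) - segmentKernel L y| :=
    integral_nonneg fun _ => abs_nonneg _
  refine (mul_le_mul_right h1 _).trans_lt ?_
  rw [← ENNReal.ofReal_coe_nnreal, ← ENNReal.ofReal_mul C.coe_nonneg,
    ENNReal.ofReal_lt_ofReal_iff hε]
  rw [lt_div_iff₀ (by positivity)] at h2
  nlinarith [mul_nonneg C.coe_nonneg hD]

end Representative

end LineIntegrals

/-! ### The main theorem -/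

theorem proposition1p2 (L : ℝ) (hL : 0 < L) (M : ℝ≥0) (m : ℕ) :
    -- the constant depends on `m`, `M` and `L` only
    ∃ C : ℝ≥0, 0 < C ∧
      ∀ φ : ℕ → LineIntegrals.E3 → ℝ,
        (∀ j, LineIntegrals.IsCubePeriodic L (φ j)) →
        (∀ j, MemLp (φ j) ∞ (LineIntegrals.cubeMeasure L)) →
        (∀ j, eLpNorm (φ j) ∞ (LineIntegrals.cubeMeasure L) ≤ M) →
        -- the integrals defining `L_n[φ_j]` and `T_m[φ_j]` converge almost everywhere
        (∀ j, ∀ n : LineIntegrals.S2, ∀ᵐ x : LineIntegrals.E3,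
          IntervalIntegrable (fun t : ℝ => φ j (x - t • (n : LineIntegrals.E3)))
            volume (-L) L) ∧
        (∀ j, ∀ᵐ x : LineIntegrals.E3,
          Integrable (fun n : LineIntegrals.S2 => (LineIntegrals.lineInt L n (φ j) x) ^ m)
            LineIntegrals.surf) ∧
        -- the sequence `T_m[φ_j]` is relatively compact in `L²(Π³)`
        (∃ hT : ∀ j, MemLp (LineIntegrals.sphereInt L m (φ j)) 2
            (LineIntegrals.cubeMeasure L),
          IsCompact (closure (Set.range fun j => (hT j).toLp
            (LineIntegrals.sphereInt L m (φ j))))) ∧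
        -- the equi-integrability estimate
        (∀ ε : ℝ, 0 < ε → ∃ h₀ : ℝ, 0 < h₀ ∧
          ∀ j, ∀ h : LineIntegrals.E3, ‖h‖ < h₀ →
            (∫⁻ x, ‖LineIntegrals.sphereInt L m (φ j) x
                - LineIntegrals.sphereInt L m (φ j) (x + h)‖ₑ ^ 2
                ∂(LineIntegrals.cubeMeasure L))
              ≤ C * (∫⁻ x, ∫⁻ n : LineIntegrals.S2, ‖LineIntegrals.lineInt L n (φ j) x
                - LineIntegrals.lineInt L n (φ j) (x + h)‖ₑ ^ 2
                ∂LineIntegrals.surf ∂(LineIntegrals.cubeMeasure L)) ∧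
            C * (∫⁻ x, ∫⁻ n : LineIntegrals.S2, ‖LineIntegrals.lineInt L n (φ j) x
                - LineIntegrals.lineInt L n (φ j) (x + h)‖ₑ ^ 2
                ∂LineIntegrals.surf ∂(LineIntegrals.cubeMeasure L))
              < ENNReal.ofReal ε) := by
  set c : ℝ≥0 := (ENNReal.ofReal (m * (2 * L * M) ^ (m - 1)) ^ 2 *
    (LineIntegrals.surf : Measure LineIntegrals.S2) Set.univ).toNNReal with hc
  have hctop : ENNReal.ofReal (m * (2 * L * M) ^ (m - 1)) ^ 2 *
      (LineIntegrals.surf : Measure LineIntegrals.S2) Set.univ ≠ ∞ :=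
    ENNReal.mul_ne_top (ENNReal.pow_ne_top ENNReal.ofReal_ne_top) (measure_ne_top _ _)
  -- `c` is the squared Lipschitz constant of `a ↦ a^m` on `[-2LM, 2LM]` times the area of the
  -- sphere; it vanishes for instance when `m = 0`, hence the `+ 1`.
  refine ⟨c + 1, by positivity, fun φ hper hmem hM => ?_⟩
  choose g hg hgM hφg using fun j => (hper j).exists_measurable_ae_eq hL (hmem j) (hM j)
  have hest : ∀ ε : ℝ, 0 < ε → ∃ h₀ : ℝ, 0 < h₀ ∧ ∀ j, ∀ h : LineIntegrals.E3, ‖h‖ < h₀ →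
      (∫⁻ x, ‖LineIntegrals.sphereInt L m (φ j) x
          - LineIntegrals.sphereInt L m (φ j) (x + h)‖ₑ ^ 2 ∂(LineIntegrals.cubeMeasure L))
        ≤ (c + 1 : ℝ≥0) * (∫⁻ x, ∫⁻ n : LineIntegrals.S2, ‖LineIntegrals.lineInt L n (φ j) x
          - LineIntegrals.lineInt L n (φ j) (x + h)‖ₑ ^ 2
          ∂LineIntegrals.surf ∂(LineIntegrals.cubeMeasure L)) ∧
      (c + 1 : ℝ≥0) * (∫⁻ x, ∫⁻ n : LineIntegrals.S2, ‖LineIntegrals.lineInt L n (φ j) x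
          - LineIntegrals.lineInt L n (φ j) (x + h)‖ₑ ^ 2
          ∂LineIntegrals.surf ∂(LineIntegrals.cubeMeasure L)) < ENNReal.ofReal ε := by
    intro ε hε
    obtain ⟨h₀, hh₀, H⟩ := LineIntegrals.exists_lintegral_lineInt_sub_sq_lt hL.le M.coe_nonneg
      (c + 1) hε
    refine ⟨h₀, hh₀, fun j h hh => ?_⟩
    rw [LineIntegrals.lintegral_sphereInt_sub_congr (hφg j),
      LineIntegrals.lintegral_lineInt_sub_congr (hφg j)]
    refine ⟨?_, H (g j) (hg j) (hgM j) h hh⟩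
    rw [← lintegral_const_mul' _ _ ENNReal.coe_ne_top]
    refine lintegral_mono fun x => ?_
    refine (LineIntegrals.enorm_sphereInt_sub_sq_le hL.le (hg j) (hgM j) m x (x + h)).trans ?_
    gcongr
    rw [ENNReal.coe_add, hc, ENNReal.coe_toNNReal hctop]
    exact le_self_add
  have hTae : ∀ j, LineIntegrals.sphereInt L m (g j)
      =ᵐ[LineIntegrals.cubeMeasure L] LineIntegrals.sphereInt L m (φ j) := fun j =>
    ae_restrict_of_ae (LineIntegrals.sphereInt_ae_eq (hφg j) m).symm
  have : IsFiniteMeasure (LineIntegrals.cubeMeasure L) :=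
    isFiniteMeasure_restrict.2 (LineIntegrals.isCompact_cube L).measure_lt_top.ne
  have hT : ∀ j, MemLp (LineIntegrals.sphereInt L m (φ j)) 2 (LineIntegrals.cubeMeasure L) :=
    fun j => (MemLp.of_bound
      (LineIntegrals.measurable_sphereInt hL.le (hg j) m).aestronglyMeasurable _ (.of_forall fun x =>
        LineIntegrals.abs_sphereInt_le hL.le (hgM j) m x)).ae_eq (hTae j)
  refine ⟨fun j n => LineIntegrals.ae_intervalIntegrable_of_ae_eq (hφg j) (hg j) (hgM j) n,
    fun j => ?_, ⟨hT, ?_⟩, hest⟩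
  · filter_upwards [LineIntegrals.ae_ae_lineInt_eq (L := L) (hφg j)] with x hx
    refine (LineIntegrals.integrable_lineInt_pow hL.le (hg j) (hgM j) m x).congr ?_
    filter_upwards [hx] with n hn
    rw [hn]
  · refine LineIntegrals.isCompact_closure_range_toLp hT fun ε hε => ?_
    obtain ⟨t, ht, hcov⟩ := LineIntegrals.exists_finite_eLpNorm_sub_lt (μ := volume)
      (LineIntegrals.isCompact_cube L) (f := fun j => LineIntegrals.sphereInt L m (g j))
      (fun j => LineIntegrals.measurable_sphereInt hL.le (hg j) m)
      (fun j x => LineIntegrals.abs_sphereInt_le hL.le (hgM j) m x)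
      (fun ε hε => by
        obtain ⟨h₀, hh₀, H⟩ := hest ε hε
        refine ⟨h₀, hh₀, fun j h hh => ?_⟩
        rw [← LineIntegrals.lintegral_sphereInt_sub_congr (hφg j)]
        exact ((H j h hh).1.trans_lt (H j h hh).2).le) hε
    refine ⟨t, ht, fun j => ?_⟩
    obtain ⟨i, hi, hij⟩ := hcov j
    refine ⟨i, hi, ?_⟩
    rwa [← eLpNorm_congr_ae ((hTae j).sub (hTae i))]
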